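/- Let $n\ge 0$ be an integer, let $\mathbf k$ be a commutative ring, and let $\mathcal A=\mathbf k[S_n]$ be the group algebra of the symmetric group $S_n$ on $[n]=\{1,\dots,n\}$ (with $(uw)(i)=u(w(i))$). For $I\subseteq[n-1]$ let $\mathbf B_I\in\mathcal A$ be the sum of all $w\in S_n$ whose descent set $\operatorname{Des}(w)=\{i\in[n-1] : w(i)>w(i+1)\}$ is contained in $I$. For a composition $\alpha=(\alpha_1,\dots,\alpha_p)$ of $n$ let $\operatorname{Set}(\alpha)=\{\alpha_1+\cdots+\alpha_i : 1\le i\le p-1\}\subseteq[n-1]$; this defines a bijection from the compositions of $n$ to the subsets of $[n-1]$, whose inverse is denoted $\operatorname{Comp}$. Put $\mathbf B_\alpha=\mathbf B_{\operatorname{Set}(\alpha)}$, let $\mathcal R_\alpha=\mathbf B_\alpha\mathcal A$ (a right ideal of $\mathcal A$), and let $\widetilde\alpha$ be the partition of $n$ obtained by sorting the parts of $\alpha$ in weakly decreasing order. For partitions $\lambda,\mu$ of $n$ write $\lambda\preceq_\pi\mu$ if some composition $\gamma$ with $\widetilde\gamma=\lambda$ can be cut into contiguous pieces whose sums are $\mu_1,\mu_2,\dots$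 (the parts of $\mu$ in weakly decreasing order), in this order. For $w\in S_n$ let $$\operatorname{LRM}(w)=\{i\in[n] : w(k)>i\text{ for all }k<w^{-1}(i)\},\qquad \operatorname{LRM}'(w)=\{\ell-1 : \ell\in\operatorname{LRM}(w),\ \ell>1\}\subseteq[n-1],$$ and $\operatorname{cLRM}'(w)=\operatorname{Comp}(\operatorname{LRM}'(w))$. Then the family $(\mathbf B_{\operatorname{LRM}'(w)}\,w)_{w\in S_n}$ is a basis of the $\mathbf k$-module $\mathcal A$, and it is adapted to all the right ideals $\mathcal R_\alpha$: for every composition $\alpha$ of $n$, $$\mathcal R_\alpha=\operatorname{span}_{\mathbf k}\bigl\{\mathbf B_{\operatorname{LRM}'(w)}\,w \;:\; w\in S_n,\ \widetilde{\operatorname{cLRM}'(w)}\preceq_\pi\widetilde\alpha\bigr\}.$$ -/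

import Mathlib

/-!
Conventions. The symmetric group `S_n` is `Equiv.Perm (Fin n)` with `(u * w) i = u (w i)`; the
element `i : Fin n` stands for the number `i + 1` of `[n] = {1, ..., n}`. Likewise a subset of
`[n - 1]` is a `Finset (Fin (n - 1))`, in which `j : Fin (n - 1)` stands for the number
`j + 1` of `[n - 1]`. This is the convention of Mathlib's `compositionAsSetEquiv`.
-/

namespace LRMBasis

/-- For `j : Fin (n - 1)` standing for the number `j + 1` of `[n - 1]`, the element of `Fin n`
that stands for the same number `j + 1`. -/
def cur {n : ℕ} (j : Fin (n - 1)) : Fin n := ⟨j, by omega⟩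

/-- For `j : Fin (n - 1)` standing for the number `j + 1` of `[n - 1]`, the element of `Fin n`
that stands for its successor `j + 2`. -/
def next {n : ℕ} (j : Fin (n - 1)) : Fin n := ⟨j + 1, by omega⟩

/-- The descent set `Des(w) = {i ∈ [n-1] | w(i) > w(i+1)}`. -/
def Des {n : ℕ} (w : Equiv.Perm (Fin n)) : Finset (Fin (n - 1)) :=
  {j | w (cur j) > w (next j)}

/-- The element `B_I`, the sum of all `w ∈ S_n` with `Des(w) ⊆ I`, of the group algebra. -/
noncomputable def B (k : Type*) [CommRing k] {n : ℕ} (I : Finset (Fin (n - 1))) :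
    MonoidAlgebra k (Equiv.Perm (Fin n)) :=
  ∑ w : Equiv.Perm (Fin n) with Des w ⊆ I, MonoidAlgebra.of k (Equiv.Perm (Fin n)) w

/-- The subset `Set(α) = {α₁, α₁ + α₂, ..., α₁ + ⋯ + α_{p-1}}` of `[n - 1]`. -/
def compSet {n : ℕ} (α : Composition n) : Finset (Fin (n - 1)) :=
  compositionAsSetEquiv n (compositionEquiv n α)

/-- The composition `Comp(I)` of `n` with `Set(Comp(I)) = I`, that is, the list of the successive
differences of `0 < i₁ < ⋯ < i_{p-1} < n` for `I = {i₁ < ⋯ < i_{p-1}}`. -/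
def compOf {n : ℕ} (I : Finset (Fin (n - 1))) : Composition n :=
  (compositionEquiv n).symm ((compositionAsSetEquiv n).symm I)

/-- The right ideal `R_α = B_α · k[S_n]`, where `B_α = B_{Set(α)}`. Right ideals of a ring `A` are
the submodules of `A` over the opposite ring. -/
noncomputable def R (k : Type*) [CommRing k] {n : ℕ} (α : Composition n) :
    Submodule (MonoidAlgebra k (Equiv.Perm (Fin n)))ᵐᵒᵖ
      (MonoidAlgebra k (Equiv.Perm (Fin n))) where
  carrier := {x | ∃ a, x = B k (compSet α) * a}
  add_mem' := by
    rintro _ _ ⟨a, rfl⟩ ⟨b, rfl⟩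
    exact ⟨a + b, (mul_add _ _ _).symm⟩
  zero_mem' := ⟨0, (mul_zero _).symm⟩
  smul_mem' := by
    rintro c _ ⟨a, rfl⟩
    exact ⟨a * c.unop, mul_assoc _ _ _⟩

/-- The composition `α` refines `β = (β₁, ..., β_p)`: it can be cut into `p` contiguous pieces
whose sums are `β₁, ..., β_p`. -/
def Refines {n : ℕ} (α β : Composition n) : Prop :=
  ∃ L : List (List ℕ), L.flatten = α.blocks ∧ L.map List.sum = β.blocks

/-- A partition, viewed as the composition that lists its parts in weakly decreasing order. -/
def toComposition {n : ℕ} (μ : n.Partition) : Composition n where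
  blocks := μ.parts.sort (· ≥ ·)
  blocks_pos := fun h => μ.parts_pos ((Multiset.mem_sort _).1 h)
  blocks_sum := by
    rw [← Multiset.sum_coe, Multiset.sort_eq, μ.parts_sum]

/-- Partition refinement `lam ⪯_π μ`: some composition whose underlying partition is `lam`
refines `μ`, viewed as a composition. -/
def PartRefines {n : ℕ} (lam μ : n.Partition) : Prop :=
  ∃ γ : Composition n, Nat.Partition.ofComposition n γ = lam ∧ Refines γ (toComposition μ)

/-- The set of left-to-right minima (as values) of `w`. -/
def LRM {n : ℕ} (w : Equiv.Perm (Fin n)) : Finset (Fin n) :=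
  {i | ∀ m : Fin n, m < w⁻¹ i → w m > i}

/-- `LRM'(w) = {ℓ - 1 | ℓ ∈ LRM(w), ℓ > 1} ⊆ [n - 1]`. -/
def LRM' {n : ℕ} (w : Equiv.Perm (Fin n)) : Finset (Fin (n - 1)) :=
  {j | next j ∈ LRM w}

/-- The LRM-composition `cLRM'(w) = Comp(LRM'(w))`. -/
def cLRM' {n : ℕ} (w : Equiv.Perm (Fin n)) : Composition n := compOf (LRM' w)

/-- The element `B_{LRM'(w)} · w` of the group algebra. -/
noncomputable def lrmElt (k : Type*) [CommRing k] {n : ℕ} (w : Equiv.Perm (Fin n)) :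
    MonoidAlgebra k (Equiv.Perm (Fin n)) :=
  B k (LRM' w) * MonoidAlgebra.of k (Equiv.Perm (Fin n)) w

end LRMBasis

namespace LRMBasis

open Equiv

/-! Read `v a < v b` as "`a` precedes `b`". For an equivalence relation `r`, let `classSum k r v` be
the sum of all permutations ordering each `r`-class as `v` does. Then `B_α w` is the class sum of
`w` for the classes `α.index (w a)` (`B_compSet_mul_of`). Call `(r, v)` Lyndon if every class starts
with its minimum. Listing the classes of a Lyndon pair by decreasing minima gives a permutation
whose left-to-right minima mark the class starts, so its class sum is some `lrmElt`
(`exists_lrmElt_eq_classSum`). Any class sum straightens into Lyndon ones with finer relations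
(`classSum_mem_span_isLyndon`). Hence the `n!` elements span the algebra, which is free of rank
`n!`, and form a basis. The same straightening puts `R_α` inside the span; conversely, merging
classes writes a class sum through coarser ones with class sizes `α`, which lie in `R_α`. -/

/-- Two permutations induce the same order on every class of `r`. -/
def SameOrder {n : ℕ} (r : Setoid (Fin n)) (v w : Perm (Fin n)) : Prop :=
  ∀ a b, r a b → (v a < v b ↔ w a < w b)

namespace SameOrder

variable {n : ℕ} {r s : Setoid (Fin n)} {u v w : Perm (Fin n)}

theorem refl (r : Setoid (Fin n)) (v : Perm (Fin n)) : SameOrder r v v := fun _ _ _ => Iff.rfl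

theorem symm (h : SameOrder r v w) : SameOrder r w v := fun a b hab => (h a b hab).symm

theorem trans (h : SameOrder r u v) (h' : SameOrder r v w) : SameOrder r u w :=
  fun a b hab => (h a b hab).trans (h' a b hab)

theorem mono (hrs : r ≤ s) (h : SameOrder s v w) : SameOrder r v w :=
  fun a b hab => h a b (hrs hab)

theorem of_imp (h : ∀ a b, r a b → v a < v b → w a < w b) : SameOrder r v w := by
  refine fun a b hab => ⟨h a b hab, fun hw => ?_⟩
  rcases lt_trichotomy (v a) (v b) with hv | hv | hv
  · exact hv
  · rw [v.injective hv] at hw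
    exact absurd hw (lt_irrefl _)
  · exact absurd hw (h b a (r.symm hab) hv).asymm

theorem eq_of_top (h : SameOrder ⊤ v w) : v = w := by
  have key : StrictMono (v * w⁻¹ : Perm (Fin n)) := fun a b hab => by
    have := (h (w⁻¹ a) (w⁻¹ b) trivial).2
    simpa using this (by simpa using hab)
  have h1 : (v * w⁻¹ : Perm (Fin n)) = 1 := by
    -- A monotone rearrangement of a family is unique, and `id` is already monotone.
    have := Tuple.unique_monotone (f := (id : Fin n → Fin n)) (σ := v * w⁻¹) (τ := 1)
      (by simpa using key.monotone) (by simpa using monotone_id)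
    ext a
    simpa using congrArg Fin.val (congrFun this a)
  exact mul_inv_eq_one.1 h1

/-- The relation of inducing the same order on every class of `r`, as a setoid. -/
def setoid (r : Setoid (Fin n)) : Setoid (Perm (Fin n)) where
  r := SameOrder r
  iseqv := ⟨refl r, symm, trans⟩

end SameOrder

open Classical in
/-- The sum of all permutations that induce the same order as `v` on every class of `r`. -/
noncomputable def classSum (k : Type*) [CommRing k] {n : ℕ} (r : Setoid (Fin n))
    (v : Perm (Fin n)) : MonoidAlgebra k (Perm (Fin n)) :=
  ∑ w : Perm (Fin n) with SameOrder r v w, MonoidAlgebra.of k (Perm (Fin n)) w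

/-! ### Class sums under refinement of the relation -/

section classSum

variable (k : Type*) [CommRing k] {n : ℕ}

theorem classSum_top (v : Perm (Fin n)) :
    classSum k ⊤ v = MonoidAlgebra.of k (Perm (Fin n)) v := by
  classical
  unfold classSum
  rw [Finset.sum_eq_single v]
  · intro b hb hne
    exact absurd (SameOrder.eq_of_top (Finset.mem_filter.1 hb).2).symm hne
  · intro h
    exact absurd (Finset.mem_filter.2 ⟨Finset.mem_univ _, SameOrder.refl _ _⟩) h

theorem classSum_congr {r : Setoid (Fin n)} {v w : Perm (Fin n)} (h : SameOrder r v w) :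
    classSum k r v = classSum k r w := by
  classical
  unfold classSum
  refine Finset.sum_congr (Finset.filter_congr fun u _ => ?_) fun _ _ => rfl
  exact ⟨h.symm.trans, h.trans⟩

/-- A sum over a set of permutations closed under `SameOrder r` is a sum of class sums. -/
theorem sum_mem_of_classSum_mem {r : Setoid (Fin n)}
    {T : Submodule k (MonoidAlgebra k (Perm (Fin n)))}
    (S : Finset (Perm (Fin n))) (hS : ∀ v ∈ S, ∀ w, SameOrder r v w → w ∈ S)
    (hT : ∀ v ∈ S, classSum k r v ∈ T) :
    ∑ w ∈ S, MonoidAlgebra.of k (Perm (Fin n)) w ∈ T := by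
  classical
  rw [Finset.sum_partition (SameOrder.setoid r)]
  refine Submodule.sum_mem _ fun q hq => ?_
  obtain ⟨v, hv, rfl⟩ := Finset.mem_image.1 hq
  convert hT v hv using 1
  unfold classSum
  refine Finset.sum_congr ?_ fun _ _ => rfl
  ext w
  simp only [Finset.mem_filter, Finset.mem_univ, true_and]
  constructor
  · rintro ⟨-, h⟩
    exact SameOrder.symm (Quotient.exact h)
  · exact fun h => ⟨hS v hv w h, Quotient.sound (SameOrder.symm h)⟩

/-- The permutations summed for `r` form a disjoint union of sets summed for the coarser `s`. -/
theorem classSum_mem_of_le {r s : Setoid (Fin n)} (hrs : r ≤ s)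
    {T : Submodule k (MonoidAlgebra k (Perm (Fin n)))} (v : Perm (Fin n))
    (hT : ∀ w, SameOrder r v w → classSum k s w ∈ T) : classSum k r v ∈ T := by
  classical
  refine sum_mem_of_classSum_mem (r := s) k _ (fun u hu w huw => ?_) fun u hu => ?_
  · simp only [Finset.mem_filter, Finset.mem_univ, true_and] at hu ⊢
    exact hu.trans (huw.mono hrs)
  · simp only [Finset.mem_filter, Finset.mem_univ, true_and] at hu
    exact hT u hu

/-- The same disjoint union, solved for the term of `v`. -/
theorem classSum_mem_of_le_of_ne {r s : Setoid (Fin n)} (hrs : r ≤ s)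
    {T : Submodule k (MonoidAlgebra k (Perm (Fin n)))} (v : Perm (Fin n))
    (hr : classSum k r v ∈ T)
    (hT : ∀ w, SameOrder r v w → ¬ SameOrder s v w → classSum k s w ∈ T) :
    classSum k s v ∈ T := by
  classical
  have h : classSum k r v = classSum k s v +
      ∑ w : Perm (Fin n) with SameOrder r v w ∧ ¬ SameOrder s v w,
        MonoidAlgebra.of k (Perm (Fin n)) w := by
    unfold classSum
    rw [← Finset.sum_filter_add_sum_filter_not (Finset.univ.filter fun w => SameOrder r v w)
      (fun w => SameOrder s v w), Finset.filter_filter, Finset.filter_filter]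
    congr 1
    refine Finset.sum_congr (Finset.filter_congr fun w _ => ?_) fun _ _ => rfl
    exact ⟨fun h => h.2, fun h => ⟨h.mono hrs, h⟩⟩
  rw [← sub_eq_iff_eq_add] at h
  rw [← h]
  refine Submodule.sub_mem _ hr ?_
  refine sum_mem_of_classSum_mem (r := s) k _ (fun u hu w huw => ?_) fun u hu => ?_
  · simp only [Finset.mem_filter, Finset.mem_univ, true_and] at hu ⊢
    exact ⟨hu.1.trans (huw.mono hrs), fun h => hu.2 (h.trans huw.symm)⟩
  · simp only [Finset.mem_filter, Finset.mem_univ, true_and] at hu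
    exact hT u hu.1 hu.2

end classSum

/-! ### Straightening into Lyndon pairs -/

/-- `m` is the smallest element of its class. -/
def IsClassMin {n : ℕ} (r : Setoid (Fin n)) (m : Fin n) : Prop := ∀ z, r m z → m ≤ z

/-- In the order induced by `v`, every class of `r` starts with its smallest element. -/
def IsLyndon {n : ℕ} (r : Setoid (Fin n)) (v : Perm (Fin n)) : Prop :=
  ∀ m, IsClassMin r m → ∀ z, r m z → v m ≤ v z

theorem exists_isClassMin {n : ℕ} (r : Setoid (Fin n)) (a : Fin n) :
    ∃ m, r m a ∧ IsClassMin r m := by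
  classical
  obtain ⟨m, hm, hmin⟩ := (Finset.univ.filter fun z => r z a).exists_min_image id
    ⟨a, Finset.mem_filter.2 ⟨Finset.mem_univ _, r.refl a⟩⟩
  simp only [Finset.mem_filter, Finset.mem_univ, true_and, id] at hm hmin
  exact ⟨m, hm, fun z hz => hmin z (r.trans (r.symm hz) hm)⟩

/-- The setoid obtained from `r` by splitting each class according to `p`. -/
def splitSetoid {n : ℕ} (r : Setoid (Fin n)) (p : Fin n → Prop) : Setoid (Fin n) where
  r a b := r a b ∧ (p a ↔ p b)
  iseqv := ⟨fun a => ⟨r.refl a, Iff.rfl⟩, fun h => ⟨r.symm h.1, h.2.symm⟩,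
    fun h h' => ⟨r.trans h.1 h'.1, h.2.trans h'.2⟩⟩

/-- If a class does not start with its minimum `m`, cut it just before `m`. The sum for the cut
relation runs over all shuffles of the two halves; in every shuffle other than `v`, fewer elements
precede `m`. The induction is on the number of related pairs, then on the number of elements
preceding their class minimum. -/
theorem classSum_mem_span_isLyndon (k : Type*) [CommRing k] {n : ℕ} (r : Setoid (Fin n))
    (v : Perm (Fin n)) :
    classSum k r v ∈ Submodule.span k
      {x | ∃ s w, s ≤ r ∧ IsLyndon s w ∧ x = classSum k s w} := by
  classical
  generalize hN : (Finset.univ.filter fun p : Fin n × Fin n => r p.1 p.2).card = N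
  induction N using Nat.strong_induction_on generalizing r v with
  | _ N ihN =>
  subst hN
  generalize hM : (Finset.univ.filter fun p : Fin n × Fin n =>
    r p.1 p.2 ∧ IsClassMin r p.1 ∧ v p.2 < v p.1).card = M
  induction M using Nat.strong_induction_on generalizing v with
  | _ M ihM =>
  subst hM
  by_cases hL : IsLyndon r v
  · exact Submodule.subset_span ⟨r, v, le_rfl, hL, rfl⟩
  obtain ⟨m, hm, z, hmz, hz⟩ : ∃ m, IsClassMin r m ∧ ∃ z, r m z ∧ v z < v m := by
    simpa [IsLyndon] using hL
  let s := splitSetoid r fun x => r m x ∧ v x < v m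
  have hsr : s ≤ r := fun _ _ h => h.1
  refine classSum_mem_of_le_of_ne k hsr v ?_ fun w hw hne => ?_
  · refine Submodule.span_mono ?_ (ihN _ (Finset.card_lt_card ?_) s v rfl)
    · rintro _ ⟨t, w, hts, hw, rfl⟩
      exact ⟨t, w, hts.trans hsr, hw, rfl⟩
    · rw [Finset.ssubset_iff_of_subset
        (Finset.monotone_filter_right _ fun p _ h => h.1)]
      refine ⟨(m, z), by simpa using hmz, fun h => ?_⟩
      have := (Finset.mem_filter.1 h).2.2.2 ⟨hmz, hz⟩
      exact lt_irrefl _ this.2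
  · refine ihM _ (Finset.card_lt_card ?_) w rfl
    -- In a shuffle, `m` still comes first in its own half.
    have hafter : ∀ y, r m y → w y < w m → v y < v m := by
      intro y hy hwy
      by_contra hvy
      exact absurd ((hw y m ⟨r.symm hy, by
        simp [hvy]⟩).2 hwy) hvy
    have hsub : ∀ x y, r x y → IsClassMin r x → w y < w x → v y < v x := by
      intro x y hxy hx hwxy
      by_cases hmx : r m x
      · have : x = m := le_antisymm (hx m (r.symm hmx)) (hm x hmx)
        subst this
        exact hafter y hxy hwxy
      · have hmy : ¬ r m y := fun h => hmx (r.trans h (r.symm hxy))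
        exact (hw y x ⟨r.symm hxy, by simp [hmx, hmy]⟩).2 hwxy
    rw [Finset.ssubset_iff_of_subset
      (Finset.monotone_filter_right _ fun p _ h => ⟨h.1, h.2.1, hsub _ _ h.1 h.2.1 h.2.2⟩)]
    -- With no strict drop, the whole early half still precedes `m`, so the shuffle is `v` itself.
    by_contra hcon
    refine hne (SameOrder.of_imp fun a b hab hvab => ?_)
    have hbefore : ∀ y, r m y → v y < v m → w y < w m := by
      intro y hy hvy
      by_contra hwy
      exact hcon ⟨(m, y), by simpa using ⟨hy, hm, hvy⟩, by simp [hwy]⟩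
    by_cases hs : (r m a ∧ v a < v m) ↔ (r m b ∧ v b < v m)
    · exact (hw a b ⟨hab, hs⟩).1 hvab
    have hma : r m a := by
      by_contra hma
      have hmb : ¬ r m b := fun h => hma (r.trans h (r.symm hab))
      exact hs (by simp [hma, hmb])
    have hmb : r m b := r.trans hma hab
    simp only [hma, hmb, true_and] at hs
    have h1 : v a < v m := by
      by_contra h1
      exact hs ⟨fun h => absurd h h1, fun h => absurd (hvab.trans h) h1⟩
    have h2 : ¬ v b < v m := fun h2 => hs ⟨fun _ => h2, fun _ => h1⟩
    have h3 : ¬ w b < w m := fun h => h2 (hafter b hmb h)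
    exact (hbefore a hma h1).trans_le (not_lt.1 h3)

/-! ### Blocks of a composition and descents -/

theorem mem_compSet {n : ℕ} {α : Composition n} {j : Fin (n - 1)} :
    j ∈ compSet α ↔ ∃ i, i ≤ α.length ∧ α.sizeUpTo i = j + 1 := by
  have h : j ∈ compSet α ↔
      (⟨1 + (j : ℕ), by omega⟩ : Fin n.succ) ∈ α.boundaries := by
    unfold compSet
    exact Set.mem_toFinset
  rw [h, Composition.boundaries]
  simp only [Finset.mem_map, Finset.mem_univ, true_and]
  constructor
  · rintro ⟨i, hi⟩
    refine ⟨i, by omega, ?_⟩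
    have := congrArg Fin.val hi
    simp only [Composition.boundary] at this
    exact this.trans (add_comm _ _)
  · rintro ⟨i, hi, h⟩
    refine ⟨⟨i, by omega⟩, Fin.ext ?_⟩
    simp only [Composition.boundary]
    exact h.trans (add_comm _ _)

theorem compSet_compOf {n : ℕ} (I : Finset (Fin (n - 1))) : compSet (compOf I) = I := by
  simp [compSet, compOf]

theorem index_monotone {n : ℕ} (α : Composition n) : Monotone α.index := by
  intro p q hpq
  by_contra! h
  have h1 : (q : ℕ) < α.sizeUpTo (α.index q + 1) := α.lt_sizeUpTo_index_succ q
  have h2 := α.sizeUpTo_index_le p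
  have h3 := α.monotone_sizeUpTo (show (α.index q).val + 1 ≤ (α.index p).val from h)
  have : (p : ℕ) ≤ q := hpq
  omega

/-- An element `j` of `compSet α` is a cut between the 0-based positions `j` and `j + 1`; the
criterion excludes cuts between `p` and `q`. -/
theorem index_eq_iff {n : ℕ} (α : Composition n) {p q : Fin n} (hpq : p < q) :
    α.index p = α.index q ↔ ∀ j ∈ compSet α, (p : ℕ) ≤ j → (q : ℕ) ≤ j := by
  constructor
  · intro h j hj hpj
    obtain ⟨i, hi, hij⟩ := mem_compSet.1 hj
    have h1 : (q : ℕ) < α.sizeUpTo (α.index q + 1) := α.lt_sizeUpTo_index_succ q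
    have h2 := α.sizeUpTo_index_le p
    rw [h] at h2
    have h3 : (α.index q).val + 1 ≤ i := by
      by_contra hlt
      have := α.monotone_sizeUpTo (show i ≤ (α.index q).val by omega)
      omega
    have := α.monotone_sizeUpTo h3
    omega
  · intro h
    refine (index_monotone α hpq.le).antisymm (not_lt.1 fun hlt => ?_)
    have h1 : (p : ℕ) < α.sizeUpTo (α.index p + 1) := α.lt_sizeUpTo_index_succ p
    have h2 := α.sizeUpTo_index_le q
    have h3 := α.monotone_sizeUpTo (show (α.index p).val + 1 ≤ (α.index q).val from hlt)
    have hq := q.2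
    have := h ⟨α.sizeUpTo (α.index q) - 1, by omega⟩
      (mem_compSet.2 ⟨α.index q, (α.index q).2.le, by dsimp only; omega⟩) (by dsimp only; omega)
    dsimp only at this
    omega

theorem Des_subset_compSet_iff {n : ℕ} (α : Composition n) (u : Perm (Fin n)) :
    Des u ⊆ compSet α ↔ ∀ p q, α.index p = α.index q → p < q → u p < u q := by
  constructor
  · intro h p q hpq hlt
    have key : ∀ d : ℕ, ∀ q : Fin n, (q : ℕ) = p + d + 1 → α.index p = α.index q → u p < u q := by
      intro d
      induction d with
      | zero =>
        intro q hq hpq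
        have hlt : p < q := by rw [Fin.lt_def]; omega
        let j : Fin (n - 1) := ⟨p, by omega⟩
        have h1 : cur j = p := rfl
        have h2 : next j = q := Fin.ext (by simp [next, j, hq])
        have hj : j ∉ compSet α := fun hj => by
          have : (q : ℕ) ≤ p := (index_eq_iff α hlt).1 hpq j hj le_rfl
          omega
        have hd : ¬ u p > u q := fun hd => hj (h (by simpa [Des, h1, h2] using hd))
        exact lt_of_le_of_ne (not_lt.1 hd) fun he => hlt.ne (u.injective he)
      | succ d ih =>
        intro q hq hpq
        let q' : Fin n := ⟨p + d + 1, by omega⟩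
        have hp' : p ≤ q' := by rw [Fin.le_def]; dsimp [q']; omega
        have hq' : q' < q := by rw [Fin.lt_def]; dsimp [q']; omega
        have h1 : α.index p = α.index q' :=
          (index_monotone α hp').antisymm (hpq ▸ index_monotone α hq'.le)
        refine (ih q' rfl h1).trans ?_
        let j : Fin (n - 1) := ⟨p + d + 1, by omega⟩
        have h3 : cur j = q' := rfl
        have h2 : next j = q := Fin.ext (by simp [next, j, hq]; omega)
        have hj : j ∉ compSet α := fun hj => by
          have : (q : ℕ) ≤ j := (index_eq_iff α hq').1 (h1.symm.trans hpq) j hj le_rfl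
          dsimp [j] at this
          omega
        have hd : ¬ u q' > u q := fun hd => hj (h (by simpa [Des, h3, h2] using hd))
        exact lt_of_le_of_ne (not_lt.1 hd) fun he => hq'.ne (u.injective he)
    have hlt' : (p : ℕ) < q := hlt
    exact key (q - p - 1) q (by omega) hpq
  · intro h j hj
    by_contra hmem
    have hlt : cur j < next j := by rw [Fin.lt_def]; simp [cur, next]
    refine absurd (h (cur j) (next j) ((index_eq_iff α hlt).2 fun i hi hle => ?_) hlt)
      (lt_asymm (by simpa [Des] using hj))
    have : i ≠ j := fun e => hmem (e ▸ hi)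
    have : (i : ℕ) ≠ j := fun e => this (Fin.ext e)
    simp only [cur, next] at hle ⊢
    omega

/-! ### The products `B_α w` as class sums -/

theorem B_compSet_mul_of (k : Type*) [CommRing k] {n : ℕ} (α : Composition n)
    (w : Perm (Fin n)) :
    B k (compSet α) * MonoidAlgebra.of k (Perm (Fin n)) w =
      classSum k (Setoid.ker fun a => α.index (w a)) w := by
  classical
  unfold B classSum
  rw [Finset.sum_mul]
  refine Finset.sum_bij' (fun u _ => u * w) (fun v _ => v * w⁻¹) ?_ ?_ ?_ ?_ ?_
  · intro u hu
    simp only [Finset.mem_filter, Finset.mem_univ, true_and] at hu ⊢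
    rw [Des_subset_compSet_iff] at hu
    exact SameOrder.of_imp fun a b hab hlt => hu (w a) (w b) hab hlt
  · intro v hv
    simp only [Finset.mem_filter, Finset.mem_univ, true_and] at hv ⊢
    rw [Des_subset_compSet_iff]
    intro p q hpq hlt
    refine (hv (w⁻¹ p) (w⁻¹ q) ?_).1 (by simpa using hlt)
    simpa [Setoid.ker_def] using hpq
  · intro u _
    simp
  · intro v _
    simp
  · intro u _
    rw [map_mul]

theorem lrmElt_eq_classSum (k : Type*) [CommRing k] {n : ℕ} (w : Perm (Fin n)) :
    lrmElt k w = classSum k (Setoid.ker fun a => (cLRM' w).index (w a)) w := by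
  rw [← B_compSet_mul_of, cLRM', compSet_compOf, lrmElt]

/-- A permutation sorting the elements by the value of an injective function. -/
theorem exists_perm_lt_iff {n : ℕ} {β : Type*} [LinearOrder β] {f : Fin n → β}
    (hf : Function.Injective f) : ∃ w : Perm (Fin n), ∀ a b, w a < w b ↔ f a < f b := by
  have hm : StrictMono (f ∘ Tuple.sort f) :=
    (Tuple.monotone_sort f).strictMono_of_injective (hf.comp (Tuple.sort f).injective)
  refine ⟨(Tuple.sort f)⁻¹, fun a b => ?_⟩
  rw [← hm.lt_iff_lt]
  simp

/-- A permutation listing the elements by the value of `g`, and those of equal value in the order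
induced by `v`. -/
theorem exists_perm_lt_of_lt {n : ℕ} {β : Type*} [LinearOrder β] (g : Fin n → β)
    (v : Perm (Fin n)) : ∃ w : Perm (Fin n), (∀ a b, g a < g b → w a < w b) ∧
      SameOrder (Setoid.ker g) v w := by
  obtain ⟨w, hw⟩ := exists_perm_lt_iff (f := fun a => toLex (g a, v a))
    (fun a b h => v.injective (congrArg (fun x => (ofLex x).2) h))
  refine ⟨w, fun a b h => (hw a b).2 (Prod.Lex.lt_iff.2 (Or.inl h)), fun a b hab => ?_⟩
  rw [hw, Prod.Lex.lt_iff]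
  have : g a = g b := hab
  simp [this]

theorem exists_lrmElt_eq_classSum {n : ℕ} {r : Setoid (Fin n)} {v : Perm (Fin n)}
    (h : IsLyndon r v) : ∃ w : Perm (Fin n), SameOrder r v w ∧
      Setoid.ker (fun a => (cLRM' w).index (w a)) = r := by
  choose μ hμr hμ using exists_isClassMin r
  have hμ_eq : ∀ {a b}, r a b → μ a = μ b := fun {a b} hab =>
    le_antisymm (hμ a _ (r.trans (hμr a) (r.trans hab (r.symm (hμr b)))))
      (hμ b _ (r.trans (hμr b) (r.trans (r.symm hab) (r.symm (hμr a)))))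
  have hker : Setoid.ker (fun a => OrderDual.toDual (μ a)) = r := by
    ext a b
    constructor
    · intro hab
      have : μ a = μ b := hab
      exact r.trans (r.symm (hμr a)) (this ▸ hμr b)
    · intro hab
      exact hμ_eq hab
  -- The order dual lists the classes by decreasing minima.
  obtain ⟨w, hw, hvw⟩ := exists_perm_lt_of_lt (fun a => OrderDual.toDual (μ a)) v
  rw [hker] at hvw
  have hw : ∀ a b, μ b < μ a → w a < w b := fun a b h => hw a b h
  refine ⟨w, hvw, ?_⟩
  have hL : ∀ a, w (μ a) ≤ w a := fun a => not_lt.1 fun hlt =>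
    absurd ((hvw _ _ (r.symm (hμr a))).2 hlt) (not_lt.2 (h _ (hμ a) _ (hμr a)))
  have hmono : ∀ {a b}, w a ≤ w b → μ b ≤ μ a := fun {a b} hab =>
    not_lt.1 fun hlt => (hw _ _ hlt).not_ge hab
  have hμle : ∀ a, μ a ≤ a := fun a => hμ a a (hμr a)
  have hμμ : ∀ a, μ (μ a) = μ a := fun a => hμ_eq (hμr a)
  suffices key : ∀ a b, w a < w b →
      ((cLRM' w).index (w a) = (cLRM' w).index (w b) ↔ r a b) by
    ext a b
    rw [Setoid.ker_def]
    rcases lt_trichotomy (w a) (w b) with hab | hab | hab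
    · exact key a b hab
    · simp [w.injective hab]
    · rw [eq_comm, key b a hab]
      exact ⟨r.symm, r.symm⟩
  intro a b hab
  rw [index_eq_iff _ hab, cLRM', compSet_compOf]
  constructor
  · intro hcut
    by_contra hr
    have hlt : μ b < μ a := lt_of_le_of_ne (hmono hab.le) fun he =>
      hr (r.trans (r.symm (hμr a)) (he ▸ hμr b))
    have h1 : (w a : ℕ) < w (μ b) := hw _ _ (by rwa [hμμ])
    have h2 : (w (μ b) : ℕ) ≤ w b := hL b
    -- The cut just before the start of the class of `b`; the subtraction is harmless since `w a < w
    -- (μ b)`.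
    let j : Fin (n - 1) := ⟨w (μ b) - 1, by have := (w (μ b)).2; omega⟩
    have hj : next j = w (μ b) := Fin.ext (by simp only [next, j]; omega)
    have := hcut j (by
      simp only [LRM', LRM, hj, Finset.mem_filter, Finset.mem_univ, true_and]
      intro m hm
      have hm : m < μ b := by simpa using hm
      by_contra! hle
      exact ((hmono hle).trans (hμle m)).not_gt (by rwa [hμμ])) (by dsimp only [j]; omega)
    dsimp only [j] at this
    omega
  · intro hr j hj haj
    by_contra! hjb
    simp only [LRM', LRM, Finset.mem_filter, Finset.mem_univ, true_and] at hj
    have hc : w (w⁻¹ (next j)) = next j := by simp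
    generalize w⁻¹ (next j) = c at hj hc
    rw [← hc] at hj
    have hcj : (w c : ℕ) = j + 1 := congrArg Fin.val hc
    have h1 : w a < w c := by rw [Fin.lt_def]; omega
    have h2 : w c ≤ w b := by rw [Fin.le_def]; omega
    -- The left-to-right minimum `c` lies between `a` and `b`, hence in their class, yet the smaller
    -- element `μ c` precedes it.
    have h3 : μ c = μ a := (hmono h1.le).antisymm (hμ_eq hr ▸ hmono h2)
    have h4 : w (μ c) < w c := h3 ▸ (hL a).trans_lt h1
    rcases (hμle c).lt_or_eq with h5 | h5
    · exact lt_asymm (hj _ h5) h4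
    · rw [h5] at h4
      exact lt_irrefl _ h4

/-! ### Partition refinement as a distribution of blocks -/

theorem exists_equiv_of_map_univ_eq {ι κ β : Type*} [Fintype ι] [Fintype κ] {b : ι → β}
    {c : κ → β} (h : Finset.univ.val.map b = Finset.univ.val.map c) :
    ∃ e : ι ≃ κ, ∀ i, c (e i) = b i := by
  classical
  have hcard : ∀ x, Nonempty ({i // b i = x} ≃ {j // c j = x}) := fun x => by
    refine ⟨Fintype.equivOfCardEq ?_⟩
    have := congrArg (Multiset.count x) h
    rw [Multiset.count_map, Multiset.count_map] at this
    rw [Fintype.card_subtype, Fintype.card_subtype]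
    simpa [Finset.card, eq_comm] using this
  refine ⟨Equiv.ofFiberEquiv fun x => (hcard x).some, fun i => ?_⟩
  exact Equiv.ofFiberEquiv_map _ i

theorem sum_singleton_eq_map {ι β : Type*} (s : Finset ι) (b : ι → β) :
    ∑ i ∈ s, ({b i} : Multiset β) = s.val.map b := by
  conv_rhs => rw [← Multiset.sum_map_singleton (s.val.map b), Multiset.map_map]
  rfl

theorem coe_flatten_ofFn {β : Type*} {m : ℕ} (f : Fin m → List β) :
    (((List.ofFn f).flatten : List β) : Multiset β) = ∑ j, (f j : Multiset β) := by
  induction m with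
  | zero => simp
  | succ m ih =>
    rw [List.ofFn_succ, List.flatten_cons, Fin.sum_univ_succ, ← Multiset.coe_add, ih]

theorem map_blocksFun_univ {n : ℕ} (α : Composition n) :
    Finset.univ.val.map α.blocksFun = (α.blocks : Multiset ℕ) := by
  conv_rhs => rw [← α.ofFn_blocksFun]
  rw [Fin.univ_val_map]

theorem card_index_fiber {n : ℕ} (α : Composition n) (i : Fin α.length) :
    (Finset.univ.filter fun a => α.index a = i).card = α.blocksFun i := by
  rw [← Fintype.card_fin (α.blocksFun i), ← Finset.card_univ,
    ← Finset.card_map (α.embedding i).toEmbedding]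
  congr 1
  ext a
  simp only [Finset.mem_filter, Finset.mem_univ, true_and, Finset.mem_map]
  rw [eq_comm, ← α.mem_range_embedding_iff']
  rfl

/-- The partition of `γ` refines that of `α` if and only if the blocks of `γ` can be distributed
so that the sums are the blocks of `α`. -/
theorem partRefines_ofComposition_iff {n : ℕ} {γ α : Composition n} :
    PartRefines (Nat.Partition.ofComposition n γ) (Nat.Partition.ofComposition n α) ↔
      ∃ h : Fin γ.length → Fin α.length,
        ∀ j, ∑ i with h i = j, γ.blocksFun i = α.blocksFun j := by
  classical
  set μ := toComposition (Nat.Partition.ofComposition n α)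
  have hμα : Finset.univ.val.map μ.blocksFun = Finset.univ.val.map α.blocksFun := by
    rw [map_blocksFun_univ, map_blocksFun_univ]
    exact Multiset.sort_eq (α.blocks : Multiset ℕ) (· ≥ ·)
  obtain ⟨e, he⟩ := exists_equiv_of_map_univ_eq hμα
  constructor
  · rintro ⟨γ', hγ', L, hL, hLμ⟩
    have hlen : L.length = μ.length := by
      rw [← List.length_map (f := List.sum), hLμ]
    -- The blocks of `γ'`, indexed by piece and place in the piece; they are those of `γ`
    -- rearranged.
    let c : (Σ j : Fin L.length, Fin (L.get j).length) → ℕ := fun p => (L.get p.1).get p.2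
    have hc : Finset.univ.val.map γ.blocksFun = Finset.univ.val.map c := by
      have h1 : (γ'.blocks : Multiset ℕ) = γ.blocks := congrArg Nat.Partition.parts hγ'
      rw [map_blocksFun_univ, ← h1, ← hL]
      conv_lhs => rw [← List.ofFn_get L]
      rw [coe_flatten_ofFn, ← sum_singleton_eq_map, Fintype.sum_sigma]
      refine Finset.sum_congr rfl fun j _ => ?_
      conv_lhs => rw [← List.ofFn_get (L.get j)]
      rw [sum_singleton_eq_map, Fin.univ_val_map]
    obtain ⟨d, hd⟩ := exists_equiv_of_map_univ_eq hc
    refine ⟨fun i => e (Fin.cast hlen (d i).1), fun j => ?_⟩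
    have hget : ∀ l : Fin L.length, (L.get l).sum = α.blocksFun (e (Fin.cast hlen l)) := by
      intro l
      rw [he]
      have hLμ' : μ.blocks = L.map List.sum := hLμ.symm
      simp [Composition.blocksFun, hLμ']
    obtain ⟨l, rfl⟩ : ∃ l : Fin L.length, e (Fin.cast hlen l) = j :=
      ⟨Fin.cast hlen.symm (e.symm j), by simp⟩
    rw [← hget, Finset.sum_filter]
    have h2 : ∀ i, γ.blocksFun i = c (d i) := fun i => (hd i).symm
    simp only [h2, e.apply_eq_iff_eq, Fin.cast_inj]
    rw [d.sum_comp (fun p => if p.1 = l then c p else 0), Fintype.sum_sigma,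
      Finset.sum_eq_single l (fun l' _ hl' => by simp [hl']) (by simp)]
    simp only [if_true]
    conv_rhs => rw [← List.ofFn_get (L.get l), List.sum_ofFn]
  · rintro ⟨h, hh⟩
    let f : Fin μ.length → List ℕ := fun j =>
      (Finset.univ.filter fun i => h i = e j).toList.map γ.blocksFun
    have hsum : (List.ofFn f).map List.sum = μ.blocks := by
      rw [List.map_ofFn, ← μ.ofFn_blocksFun]
      congr 1
      ext j
      simp only [Function.comp, f, Finset.sum_map_toList, hh, he]
    have hflat : (((List.ofFn f).flatten : List ℕ) : Multiset ℕ) = γ.blocks := by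
      rw [← map_blocksFun_univ, coe_flatten_ofFn, ← sum_singleton_eq_map]
      have hf : ∀ j, (f j : Multiset ℕ) = ∑ i with h i = e j, {γ.blocksFun i} := fun j => by
        rw [sum_singleton_eq_map, ← Multiset.map_coe, Finset.coe_toList]
      simp only [hf]
      rw [e.sum_comp fun j => ∑ i with h i = j, ({γ.blocksFun i} : Multiset ℕ),
        Finset.sum_fiberwise]
    refine ⟨⟨(List.ofFn f).flatten, fun {i} hi => ?_, ?_⟩, ?_, List.ofFn f, rfl, hsum⟩
    · rw [← Multiset.mem_coe, hflat, Multiset.mem_coe] at hi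
      exact γ.blocks_pos hi
    · rw [← Multiset.sum_coe, hflat, Multiset.sum_coe, γ.blocks_sum]
    · exact Nat.Partition.ext hflat

/-- Block sizes are class sizes, and each coarse class is a union of fine ones. -/
theorem partRefines_of_ker_le {n : ℕ} {γ α : Composition n} {v w : Perm (Fin n)}
    (h : Setoid.ker (fun a => γ.index (v a)) ≤ Setoid.ker (fun a => α.index (w a))) :
    PartRefines (Nat.Partition.ofComposition n γ) (Nat.Partition.ofComposition n α) := by
  classical
  rw [partRefines_ofComposition_iff]
  have hsurj : ∀ i : Fin γ.length, ∃ a, γ.index (v a) = i := fun i =>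
    ⟨v⁻¹ (γ.embedding i ⟨0, γ.one_le_blocksFun i⟩), by simp⟩
  choose s hs using hsurj
  have hfac : ∀ a, α.index (w (s (γ.index (v a)))) = α.index (w a) := fun a => h (hs _)
  have hcard : ∀ {δ : Composition n} (u : Perm (Fin n)) (i : Fin δ.length),
      (Finset.univ.filter fun a => δ.index (u a) = i).card = δ.blocksFun i := fun u i => by
    rw [← card_index_fiber, ← Finset.card_map u.toEmbedding]
    congr 1
    ext a
    simp
  refine ⟨fun i => α.index (w (s i)), fun j => ?_⟩
  rw [← hcard w j, Finset.card_eq_sum_card_fiberwise (f := fun a => γ.index (v a))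
    (t := Finset.univ.filter fun i => α.index (w (s i)) = j)]
  · refine Finset.sum_congr rfl fun i hi => ?_
    rw [← hcard v i, Finset.filter_filter]
    congr 1
    ext a
    simp only [Finset.mem_filter, Finset.mem_univ, true_and] at hi ⊢
    constructor
    · rintro rfl
      exact ⟨(hfac a).symm.trans hi, rfl⟩
    · exact fun h => h.2
  · intro a ha
    simpa [hfac] using ha

/-! ### The right ideals and the basis -/

theorem coe_R_eq_range (k : Type*) [CommRing k] {n : ℕ} (α : Composition n) :
    (R k α : Set (MonoidAlgebra k (Perm (Fin n)))) =
      LinearMap.range (LinearMap.mulLeft k (B k (compSet α))) := by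
  ext x
  constructor
  · rintro ⟨a, rfl⟩
    exact ⟨a, rfl⟩
  · rintro ⟨a, rfl⟩
    exact ⟨a, rfl⟩

/-- Listing the classes in the order of `g` turns them into the blocks of `α`, so the class sum
equals some `B_α w`. -/
theorem classSum_ker_mem_range (k : Type*) [CommRing k] {n : ℕ} (α : Composition n)
    (g : Fin n → Fin α.length)
    (hg : ∀ j, (Finset.univ.filter fun a => g a = j).card = α.blocksFun j) (v : Perm (Fin n)) :
    classSum k (Setoid.ker g) v ∈ LinearMap.range (LinearMap.mulLeft k (B k (compSet α))) := by
  classical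
  obtain ⟨w, hw, hvw⟩ := exists_perm_lt_of_lt g v
  have hmono : Monotone (g ∘ (w⁻¹ : Perm (Fin n))) := by
    intro p q hpq
    by_contra! hlt
    exact (hw _ _ hlt).not_ge (by simpa using hpq)
  obtain ⟨e, he⟩ := exists_equiv_of_map_univ_eq (b := g) (c := α.index) (by
    ext j
    rw [Multiset.count_map, Multiset.count_map]
    have := (hg j).trans (card_index_fiber α j).symm
    simpa [Finset.card, eq_comm] using this)
  have heq : g = fun a => α.index (w a) := by
    have h1 : g = α.index ∘ e := funext fun a => (he a).symm
    -- Both `g ∘ w⁻¹` and `α.index` are monotone rearrangements of one family.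
    have h2 := Tuple.unique_monotone (f := α.index) (σ := e * w⁻¹) (τ := 1)
      (by rw [h1] at hmono; exact hmono) (index_monotone α)
    funext a
    have h3 := congrFun h2 (w a)
    simpa [he] using h3
  refine ⟨MonoidAlgebra.of k _ w, ?_⟩
  rw [LinearMap.mulLeft_apply, B_compSet_mul_of, classSum_congr k hvw, ← heq]

theorem range_mulLeft_B_eq_span (k : Type*) [CommRing k] {n : ℕ} (α : Composition n) :
    LinearMap.range (LinearMap.mulLeft k (B k (compSet α))) =
      Submodule.span k {x | ∃ w : Perm (Fin n),
        PartRefines (Nat.Partition.ofComposition n (cLRM' w)) (Nat.Partition.ofComposition n α) ∧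
          x = lrmElt k w} := by
  apply le_antisymm
  · rintro _ ⟨x, rfl⟩
    induction x using MonoidAlgebra.induction_on with
    | of v =>
      rw [LinearMap.mulLeft_apply, B_compSet_mul_of]
      refine Submodule.span_le.2 ?_ (classSum_mem_span_isLyndon k _ v)
      rintro _ ⟨s, u, hs, hu, rfl⟩
      obtain ⟨w, huw, hker⟩ := exists_lrmElt_eq_classSum hu
      refine Submodule.subset_span ⟨w, partRefines_of_ker_le (hker.trans_le hs), ?_⟩
      rw [lrmElt_eq_classSum, hker, classSum_congr k huw]
    | add x y hx hy =>
      rw [map_add]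
      exact Submodule.add_mem _ hx hy
    | smul c x hx =>
      rw [map_smul]
      exact Submodule.smul_mem _ c hx
  · rw [Submodule.span_le]
    rintro _ ⟨w, hw, rfl⟩
    classical
    obtain ⟨h, hh⟩ := partRefines_ofComposition_iff.1 hw
    rw [lrmElt_eq_classSum]
    -- Merging classes along `h` gives classes of sizes `α`.
    refine classSum_mem_of_le k (s := Setoid.ker fun a => h ((cLRM' w).index (w a)))
      (fun a b hab => congrArg h hab) w fun v _ => classSum_ker_mem_range k α _ (fun j => ?_) v
    rw [← hh j, Finset.card_eq_sum_card_fiberwise (f := fun a => (cLRM' w).index (w a))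
      (t := Finset.univ.filter fun i => h i = j) (fun a ha => by simpa using ha)]
    refine Finset.sum_congr rfl fun i hi => ?_
    rw [← card_index_fiber, ← Finset.card_map w.toEmbedding, Finset.filter_filter]
    congr 1
    ext a
    simp only [Finset.mem_filter, Finset.mem_univ, true_and, Finset.mem_map_equiv,
      Equiv.apply_symm_apply] at hi ⊢
    constructor
    · exact fun h => h.2
    · rintro rfl
      exact ⟨hi, rfl⟩

theorem span_range_lrmElt (k : Type*) [CommRing k] (n : ℕ) :
    Submodule.span k (Set.range fun w : Perm (Fin n) => lrmElt k w) = ⊤ := by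
  rw [eq_top_iff]
  rintro x -
  induction x using MonoidAlgebra.induction_on with
  | of v =>
    rw [← classSum_top]
    refine Submodule.span_le.2 ?_ (classSum_mem_span_isLyndon k _ v)
    rintro _ ⟨s, u, -, hu, rfl⟩
    obtain ⟨w, huw, hker⟩ := exists_lrmElt_eq_classSum hu
    refine Submodule.subset_span ⟨w, ?_⟩
    simp only
    rw [lrmElt_eq_classSum, hker, classSum_congr k huw]
  | add x y hx hy => exact Submodule.add_mem _ hx hy
  | smul c x hx => exact Submodule.smul_mem _ c hx

theorem linearIndependent_lrmElt (k : Type*) [CommRing k] (n : ℕ) :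
    LinearIndependent k (fun w : Perm (Fin n) => lrmElt k w) := by
  nontriviality k
  refine linearIndependent_of_top_le_span_of_card_eq_finrank (span_range_lrmElt k n).ge ?_
  exact (Module.finrank_eq_card_basis (MonoidAlgebra.basis (Perm (Fin n)) k)).symm

end LRMBasis

theorem mainTheorem1 (k : Type*) [CommRing k] (n : ℕ) :
    (LinearIndependent k (fun w : Equiv.Perm (Fin n) => LRMBasis.lrmElt k w) ∧
      Submodule.span k (Set.range fun w : Equiv.Perm (Fin n) => LRMBasis.lrmElt k w) = ⊤) ∧
    ∀ α : Composition n,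
      (LRMBasis.R k α : Set (MonoidAlgebra k (Equiv.Perm (Fin n)))) =
        (Submodule.span k {x | ∃ w : Equiv.Perm (Fin n),
          LRMBasis.PartRefines (Nat.Partition.ofComposition n (LRMBasis.cLRM' w))
            (Nat.Partition.ofComposition n α) ∧
          x = LRMBasis.lrmElt k w} : Submodule k (MonoidAlgebra k (Equiv.Perm (Fin n)))) := by
  refine ⟨⟨LRMBasis.linearIndependent_lrmElt k n, LRMBasis.span_range_lrmElt k n⟩, fun α => ?_⟩
  rw [LRMBasis.coe_R_eq_range, LRMBasis.range_mulLeft_B_eq_span]
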